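/- Let $\mathrm{Inv}\langle A\mid R\rangle$ be a finite presentation of an inverse monoid: $A$ is a finite set, $\widetilde A=A\cup A^{-1}$, $R$ is a finite subset of $\widetilde A^*\times\widetilde A^*$, and $$M=\widetilde A^*/(\rho_A\cup R)^{\sharp},$$ where $\rho_A$ is the congruence on $\widetilde A^*$ generated by all pairs $(ww^{-1}w,w)$ and $(uu^{-1}vv^{-1},vv^{-1}uu^{-1})$ with $u,v,w\in\widetilde A^*$, and $X^\sharp$ denotes the congruence generated by $X$. Fix a letter $a_i\in A$, put $A_i=A\setminus\{a_i\}$, let $\theta_i:\widetilde A^*\to\widetilde{A_i}^*$ be the homomorphism that erases all occurrences of $a_i$ and $a_i^{-1}$, and let $$M_i=\widetilde{A_i}^*/(\rho_{A_i}\cup\{(r\theta_i,s\theta_i):(r,s)\in R\})^{\sharp}.$$ Let $\varepsilon_i:M\to M_i$ be the homomorphism sending the class of a word $w$ to the class of $w\theta_i$. For elements of an inverse monoid write $u\,\mathcal R\,v$ if $uu^{-1}=vv^{-1}$, and $u\le v$ if $u=ev$ for some idempotent $e$; an inverse monoid has finite $\mathcal R$-classes if each of its $\mathcal R$-classes is a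 finite set. **Proposition.** Suppose that $M$ has finite $\mathcal R$-classes and that for every idempotent $e$ of $M_i$ the preimage $\varepsilon_i^{-1}(e)=\{g\in M:\varepsilon_i(g)=e\}$ has a minimum idempotent, i.e. it contains an idempotent $f$ such that $f\le g$ for every idempotent $g\in\varepsilon_i^{-1}(e)$. Then $M_i$ also has finite $\mathcal R$-classes. -/

import Mathlib

/-- An inverse monoid: a monoid in which every element `x` has exactly one inverse `x⁻¹`,
in the sense that `x * x⁻¹ * x = x` and `x⁻¹ * x * x⁻¹ = x⁻¹`. -/
class InverseMonoid (M : Type*) extends Monoid M, Inv M where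
  mul_inv_mul : ∀ x : M, x * x⁻¹ * x = x
  inv_mul_inv : ∀ x : M, x⁻¹ * x * x⁻¹ = x⁻¹
  inv_unique : ∀ x y : M, x * y * x = x → y * x * y = y → y = x⁻¹

namespace InverseMonoid

variable {M : Type*} [InverseMonoid M]

/-- Green's relation `𝓡` on an inverse monoid: `u 𝓡 v` iff `u u⁻¹ = v v⁻¹`. -/
def GreenR (u v : M) : Prop := u * u⁻¹ = v * v⁻¹

/-- The natural partial order on an inverse monoid: `u ≤ v` iff `u = e v` for some
idempotent `e`. -/
def NatLE (u v : M) : Prop := ∃ e : M, IsIdempotentElem e ∧ u = e * v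

/-- `f` is a minimum idempotent of `S`: it is an idempotent of `S` lying below every
idempotent of `S` in the natural partial order. -/
def IsMinimumIdempotent (S : Set M) (f : M) : Prop :=
  f ∈ S ∧ IsIdempotentElem f ∧ ∀ g ∈ S, IsIdempotentElem g → NatLE f g

variable (M) in
/-- `M` has finite `𝓡`-classes: the `𝓡`-class of every element is finite. -/
def HasFiniteRClasses : Prop := ∀ u : M, {v : M | GreenR v u}.Finite

end InverseMonoid

namespace InvPres

/-- Words over `A ∪ A⁻¹`; the letter `(a, true)` is `a` and `(a, false)` is `a⁻¹`. -/
abbrev Word (A : Type*) := FreeMonoid (A × Bool)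

/-- The involution on words: reverse the word and invert each letter. -/
def Word.inv {A : Type*} (w : Word A) : Word A :=
  FreeMonoid.ofList ((w.toList.map fun x => (x.1, !x.2)).reverse)

theorem Word.inv_one {A : Type*} : Word.inv (1 : Word A) = 1 := rfl

theorem Word.inv_of {A : Type*} (x : A × Bool) :
    Word.inv (FreeMonoid.of x) = FreeMonoid.of (x.1, !x.2) := rfl

theorem Word.inv_mul {A : Type*} (u v : Word A) :
    Word.inv (u * v) = Word.inv v * Word.inv u := by
  simp [Word.inv, FreeMonoid.toList_mul, FreeMonoid.ofList_append]

theorem Word.inv_inv {A : Type*} (w : Word A) : Word.inv (Word.inv w) = w := by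
  simp [Word.inv, List.map_reverse, Function.comp_def]

/-- The pairs generating the Vagner congruence. -/
inductive VagnerRel {A : Type*} : Word A → Word A → Prop
  | regular (w : Word A) : VagnerRel (w * w.inv * w) w
  | comm (u v : Word A) : VagnerRel (u * u.inv * (v * v.inv)) (v * v.inv * (u * u.inv))

/-- The congruence `(ρ_A ∪ R)^♯` on words. -/
def presCon {A : Type*} (R : Set (Word A × Word A)) : Con (Word A) :=
  conGen fun u v => VagnerRel u v ∨ (u, v) ∈ R

/-- The inverse monoid `Inv⟨A | R⟩`. -/
abbrev InvMon {A : Type*} (R : Set (Word A × Word A)) : Type _ := (presCon R).Quotient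

section Inverse

variable {A : Type*} {R : Set (Word A × Word A)}

theorem mk_regular (w : Word A) : (w : InvMon R) * (w.inv : Word A) * w = w :=
  (Con.eq (presCon R)).2 (ConGen.Rel.of _ _ (Or.inl (VagnerRel.regular w)))

theorem mk_regular' (w : Word A) :
    ((w.inv : Word A) : InvMon R) * w * (w.inv : Word A) = (w.inv : Word A) := by
  have h := mk_regular (R := R) w.inv
  rwa [Word.inv_inv] at h

theorem mk_comm (u v : Word A) :
    (u : InvMon R) * (u.inv : Word A) * ((v : InvMon R) * (v.inv : Word A)) =
      (v : InvMon R) * (v.inv : Word A) * ((u : InvMon R) * (u.inv : Word A)) :=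
  (Con.eq (presCon R)).2 (ConGen.Rel.of _ _ (Or.inl (VagnerRel.comm u v)))

theorem mk_comm' (u v : Word A) :
    ((u.inv : Word A) : InvMon R) * u * (((v.inv : Word A) : InvMon R) * v) =
      ((v.inv : Word A) : InvMon R) * v * (((u.inv : Word A) : InvMon R) * u) := by
  have h := mk_comm (R := R) u.inv v.inv
  rwa [Word.inv_inv, Word.inv_inv] at h

theorem idem_eq {w : Word A} (h : (w : InvMon R) * w = w) :
    (w : InvMon R) = (w.inv : Word A) := by
  have h1 := mk_regular (R := R) w
  have h2 := mk_regular' (R := R) w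
  have h3 := mk_comm (R := R) w w.inv
  rw [Word.inv_inv] at h3
  generalize (w : InvMon R) = e at *
  generalize ((w.inv : Word A) : InvMon R) = f at *
  have hff : f * f = f := by
    have hf : f = f * e * (e * f) := by
      calc f = f * e * f := h2.symm
        _ = f * (e * e) * f := by rw [h]
        _ = _ := by simp only [mul_assoc]
    have hf' : f = e * f * (f * e) := hf.trans h3.symm
    have hp : f * e * (f * e) = f * e := by rw [← mul_assoc, h2]
    have hq : e * f * (e * f) = e * f := by rw [← mul_assoc, h1]
    calc f * f = e * f * (f * e) * (f * e * (e * f)) := by rw [← hf, ← hf']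
      _ = e * f * (f * e * (f * e)) * (e * f) := by simp only [mul_assoc]
      _ = f * e * (e * f * (e * f)) := by rw [hp, h3]; simp only [mul_assoc]
      _ = f := by rw [hq, ← hf]
  calc e = e * f * e := h1.symm
    _ = e * (f * f) * e := by rw [hff]
    _ = e * f * (f * e) := by simp only [mul_assoc]
    _ = f * e * (e * f) := h3
    _ = f * (e * e) * f := by simp only [mul_assoc]
    _ = f := by rw [h, h2]

theorem inverse_unique (x y z : InvMon R) (hzx : z * x * z = z) (hxz : x * z * x = x)
    (hzy : z * y * z = z) (hyz : y * z * y = y) : x = y := by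
  have idem : ∀ p : InvMon R, p * p = p → ∃ w : Word A, p = (w : InvMon R) * (w.inv : Word A) := by
    intro p
    induction p using Con.induction_on with
    | _ w => intro hp; exact ⟨w, by rw [← idem_eq hp, hp]⟩
  have comm : ∀ p q : InvMon R, p * p = p → q * q = q → p * q = q * p := by
    intro p q hp hq
    obtain ⟨u, rfl⟩ := idem p hp
    obtain ⟨v, rfl⟩ := idem q hq
    exact mk_comm u v
  have i1 : z * x * (z * x) = z * x := by rw [← mul_assoc, hzx]
  have i2 : z * y * (z * y) = z * y := by rw [← mul_assoc, hzy]
  have i3 : x * z * (x * z) = x * z := by rw [← mul_assoc, hxz]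
  have i4 : y * z * (y * z) = y * z := by rw [← mul_assoc, hyz]
  calc x = x * (z * y * z) * x := by rw [hzy, hxz]
    _ = x * (z * y * (z * x)) := by simp only [mul_assoc]
    _ = x * (z * x * (z * y)) := by rw [comm _ _ i2 i1]
    _ = x * z * x * z * y := by simp only [mul_assoc]
    _ = x * z * (y * z * y) := by rw [hxz, hyz]
    _ = x * z * (y * z) * y := by simp only [mul_assoc]
    _ = y * z * (x * z) * y := by rw [comm _ _ i3 i4]
    _ = y * (z * x * z) * y := by simp only [mul_assoc]
    _ = y := by rw [hzx, hyz]

theorem inv_congr {u v : Word A} (h : presCon R u v) : presCon R u.inv v.inv := by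
  refine (Con.eq (presCon R)).1 ?_
  have huv : (u : InvMon R) = v := (Con.eq (presCon R)).2 h
  refine inverse_unique _ _ (u : InvMon R) (mk_regular u) (mk_regular' u) ?_ ?_
  · rw [huv]; exact mk_regular v
  · rw [huv]; exact mk_regular' v

/-- `Inv⟨A | R⟩` is an inverse monoid, the inverse of the class of `w` being the class of the
formal inverse of `w`. -/
instance instInverseMonoid : InverseMonoid (InvMon R) where
  toMonoid := inferInstance
  inv x := Con.liftOn x (fun w => ((w.inv : Word A) : InvMon R))
    fun _ _ h => (Con.eq (presCon R)).2 (inv_congr h)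
  mul_inv_mul x := by
    induction x using Con.induction_on with
    | _ w => exact mk_regular w
  inv_mul_inv x := by
    induction x using Con.induction_on with
    | _ w => exact mk_regular' w
  inv_unique x y h1 h2 := by
    induction x using Con.induction_on with
    | _ w => exact inverse_unique _ _ _ h1 h2 (mk_regular w) (mk_regular' w)

end Inverse

/-- The alphabet `A` with the letter `a` removed. -/
abbrev Rest {A : Type*} (a : A) : Type _ := {b : A // b ≠ a}

open Classical in
/-- The homomorphism `θ` erasing all occurrences of `a` and `a⁻¹` from a word. -/
noncomputable def erase {A : Type*} (a : A) : Word A →* Word (Rest a) :=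
  FreeMonoid.lift fun x => if h : x.1 = a then 1 else FreeMonoid.of (⟨x.1, h⟩, x.2)

/-- The relations obtained from `R` by erasing the letter `a` in both sides. -/
def eraseRel {A : Type*} (a : A) (R : Set (Word A × Word A)) :
    Set (Word (Rest a) × Word (Rest a)) :=
  (fun p => (erase a p.1, erase a p.2)) '' R

theorem erase_inv {A : Type*} (a : A) (w : Word A) : erase a w.inv = (erase a w).inv := by
  induction w using FreeMonoid.inductionOn' with
  | one => simp [Word.inv_one]
  | of_mul x w ih =>
    rw [Word.inv_mul, map_mul, map_mul, Word.inv_mul, ih, Word.inv_of]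
    congr 1
    by_cases h : x.1 = a <;> simp [erase, h, Word.inv_one, Word.inv_of]

/-- The component `M_i` of `Inv⟨A | R⟩` for the letter `a = a_i`, namely the inverse monoid
presented by the remaining letters and the erased relations. -/
abbrev Component {A : Type*} (a : A) (R : Set (Word A × Word A)) : Type _ :=
  InvMon (eraseRel a R)

theorem presCon_le_ker {A : Type*} (a : A) (R : Set (Word A × Word A)) :
    presCon R ≤ Con.ker ((presCon (eraseRel a R)).mk'.comp (erase a)) := by
  refine Con.conGen_le.2 ?_
  rintro u v (h | h)
  · refine (Con.eq (presCon (eraseRel a R))).2 ?_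
    cases h with
    | regular w =>
      simp only [map_mul, erase_inv]
      exact ConGen.Rel.of _ _ (Or.inl (VagnerRel.regular _))
    | comm u v =>
      simp only [map_mul, erase_inv]
      exact ConGen.Rel.of _ _ (Or.inl (VagnerRel.comm _ _))
  · exact (Con.eq (presCon (eraseRel a R))).2
      (ConGen.Rel.of _ _ (Or.inr ⟨(u, v), h, rfl⟩))

/-- The eraser morphism `ε_i : M → M_i` for `a = a_i`, sending the class of a word `w` to the
class of the word obtained from `w` by erasing `a` and `a⁻¹`. -/
noncomputable def eraser {A : Type*} (a : A) (R : Set (Word A × Word A)) :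
    InvMon R →* Component a R :=
  (presCon R).lift ((presCon (eraseRel a R)).mk'.comp (erase a)) (presCon_le_ker a R)

end InvPres

/-!
Let `φ : M → N` be a surjective morphism of inverse monoids, let `f` be the minimum idempotent of
the fibre of `φ` over `u u⁻¹`, and let `φ g 𝓡 u`. Then `g g⁻¹` lies in that fibre, so `f ≤ g g⁻¹`,
which gives `f g 𝓡 f`, while `φ (f g) = u u⁻¹ φ g = φ g`. So every element of the `𝓡`-class of `u`
is the image of an element of the `𝓡`-class of `f`.
-/

namespace InverseMonoid

section Monoid

variable {M : Type*} [InverseMonoid M]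

theorem isIdempotentElem_mul_inv (x : M) : IsIdempotentElem (x * x⁻¹) := by
  rw [IsIdempotentElem, ← mul_assoc, mul_inv_mul]

theorem NatLE.mul_eq_left {x e : M} (hxe : NatLE x e) (he : IsIdempotentElem e) : x * e = x := by
  obtain ⟨d, -, rfl⟩ := hxe
  rw [mul_assoc, he.eq]

theorem mul_inv_rev_of_mul_mul_inv_eq {x y : M} (h : x * (y * y⁻¹) = x) :
    (x * y)⁻¹ = y⁻¹ * x⁻¹ := by
  refine (inv_unique _ _ ?_ ?_).symm
  · calc x * y * (y⁻¹ * x⁻¹) * (x * y) = x * (y * y⁻¹) * x⁻¹ * x * y := by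
          simp only [mul_assoc]
      _ = x * y := by rw [h, mul_inv_mul]
  · calc y⁻¹ * x⁻¹ * (x * y) * (y⁻¹ * x⁻¹) = y⁻¹ * (x⁻¹ * (x * (y * y⁻¹)) * x⁻¹) := by
          simp only [mul_assoc]
      _ = y⁻¹ * x⁻¹ := by rw [h, inv_mul_inv]

theorem greenR_mul_of_natLE_mul_inv {x y : M} (h : NatLE x (y * y⁻¹)) : GreenR (x * y) x := by
  have hxy : x * (y * y⁻¹) = x := h.mul_eq_left (isIdempotentElem_mul_inv y)
  calc x * y * (x * y)⁻¹ = x * (y * y⁻¹) * x⁻¹ := by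
        simp only [mul_inv_rev_of_mul_mul_inv_eq hxy, mul_assoc]
    _ = x * x⁻¹ := by rw [hxy]

end Monoid

section Hom

variable {M N F : Type*} [InverseMonoid M] [InverseMonoid N] [FunLike F M N] [MulHomClass F M N]

protected theorem map_inv (φ : F) (x : M) : φ x⁻¹ = (φ x)⁻¹ :=
  inv_unique _ _ (by simp only [← map_mul, mul_inv_mul]) (by simp only [← map_mul, inv_mul_inv])

theorem IsMinimumIdempotent.greenR_mul_and_map_mul_eq {φ : F} {u : N} {f g : M}
    (hf : IsMinimumIdempotent {x | φ x = u * u⁻¹} f) (hg : GreenR (φ g) u) :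
    GreenR (f * g) f ∧ φ (f * g) = φ g := by
  obtain ⟨hφf : φ f = u * u⁻¹, -, hf_le⟩ := hf
  have hφg : φ (g * g⁻¹) = u * u⁻¹ := by rw [map_mul, InverseMonoid.map_inv, hg]
  refine ⟨greenR_mul_of_natLE_mul_inv (hf_le _ hφg (isIdempotentElem_mul_inv g)), ?_⟩
  rw [map_mul, hφf, ← hg, mul_inv_mul]

end Hom

end InverseMonoid

namespace InvPres

variable {A : Type*} (a : A)

theorem erase_surjective : Function.Surjective (erase a) := by
  intro w
  induction w using FreeMonoid.inductionOn' with
  | one => exact ⟨1, map_one _⟩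
  | of_mul x w ih =>
    obtain ⟨v, rfl⟩ := ih
    exact ⟨FreeMonoid.of (x.1.1, x.2) * v, by simp [erase, x.1.2]⟩

theorem eraser_surjective (R : Set (Word A × Word A)) : Function.Surjective (eraser a R) :=
  Con.lift_surjective_of_surjective (presCon_le_ker a R)
    (Con.mk'_surjective.comp (erase_surjective a))

end InvPres

open InverseMonoid in
theorem proposition4p16_general {M N F : Type*} [InverseMonoid M] [InverseMonoid N]
    [FunLike F M N] [MulHomClass F M N] (φ : F) (hφ : Function.Surjective φ)
    (hM : HasFiniteRClasses M)
    (hmin : ∀ e : N, IsIdempotentElem e → ∃ f : M, IsMinimumIdempotent {g | φ g = e} f) :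
    HasFiniteRClasses N := by
  intro u
  obtain ⟨f, hf⟩ := hmin (u * u⁻¹) (isIdempotentElem_mul_inv u)
  refine ((hM f).image φ).subset fun v hv => ?_
  obtain ⟨g, rfl⟩ := hφ v
  exact ⟨f * g, hf.greenR_mul_and_map_mul_eq hv⟩

theorem proposition4p16 {A : Type*} [Finite A]
    (R : Set (InvPres.Word A × InvPres.Word A)) (hR : R.Finite) (a : A)
    (hM : InverseMonoid.HasFiniteRClasses (InvPres.InvMon R))
    (hmin : ∀ e : InvPres.Component a R, IsIdempotentElem e →
      ∃ f : InvPres.InvMon R,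
        InverseMonoid.IsMinimumIdempotent {g : InvPres.InvMon R | InvPres.eraser a R g = e} f) :
    InverseMonoid.HasFiniteRClasses (InvPres.Component a R) :=
  proposition4p16_general (InvPres.eraser a R) (InvPres.eraser_surjective a R) hM hmin
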